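/- Let $n\ge 2$, let $\mathbb{S}^n$ be the space of real symmetric $n\times n$ matrices with the inner product $\langle A,B\rangle=\mathrm{Tr}(AB)$ and Frobenius norm $\|\cdot\|_F$, let $\lambda_1(A)\ge\dots\ge\lambda_n(A)$ be the eigenvalues of $A\in\mathbb{S}^n$, and let $\mathcal{S}_n=\{X\in\mathbb{S}^n: X\succeq 0,\ \mathrm{Tr}(X)=1\}$. Let $f:\mathbb{S}^n\to\mathbb{R}$ be convex and $\beta$-smooth on $\mathcal{S}_n$, where $\beta>0$ (that is, $f$ is differentiable at the points of $\mathcal{S}_n$ and $\|\nabla f(X)-\nabla f(Y)\|_F\le\beta\|X-Y\|_F$ for $X,Y\in\mathcal{S}_n$), and put $f^*=\min_{\mathcal{S}_n}f$. Algorithm 2 starts at an arbitrary $X_1\in\mathcal{S}_n$, and for $t=1,2,\dots$ it does the following. Let $Y_{t+1}=X_t-\frac1\beta\nabla f(X_t)$. If $\lambda_1(Y_{t+1})\ge 1+\lambda_2(Y_{t+1})$, then $X_{t+1}=u_1u_1^\top$, where $u_1$ is a unit eigenvector of $Y_{t+1}$ for $\lambda_1(Y_{t+1})$. Otherwise $X_{t+1}=(1-\eta_t)X_t+\eta_tv_tv_t^\top$,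 where $v_t$ is a unit eigenvector of $-\nabla f(X_t)$ for its largest eigenvalue and $\eta_t\in[0,1]$ minimizes over $\eta\in[0,1]$ either $f((1-\eta)X_t+\eta v_tv_t^\top)$ (option 1) or $f(X_t)+\eta\langle v_tv_t^\top-X_t,\nabla f(X_t)\rangle+\frac{\eta^2\beta}{2}\|X_t-v_tv_t^\top\|_F^2$ (option 2). Then there is an absolute constant $K>0$ (independent of $n$, $f$, $\beta$ and all other data) such that every sequence $(X_t)_{t\ge1}$ produced by Algorithm 2 satisfies the following, with $h_t=f(X_t)-f^*$. 1. $h_t\le K\beta/t$ for all $t\ge 2$. Suppose moreover that there is a minimizer $X^*$ of $f$ over $\mathcal{S}_n$ with $\delta:=\lambda_{n-1}(\nabla f(X^*))-\lambda_n(\nabla f(X^*))>0$. Then: 2. There is an integer $T_0\ge 0$ with $T_0\le K(\beta/\delta)^3$ such that $h_{t+1}\le h_t\left(1-\min\{\frac{\delta}{12\beta},\frac12\}\right)$ for all $t\ge 1$ with $t\ge T_0$. 3. For all $t\ge1$ and every unit eigenvector $v$ of $-\nabla f(X_t)$ for its largest eigenvalue (in particular for $v=v_t$), $\|vv^\top-X^*\|_F^2\le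 K\frac{\beta^2}{\delta^3}h_t$. 4. There is an integer $T_1\ge 0$ with $T_1\le K(\beta/\delta)^3$ such that $\mathrm{rank}(X_t)=1$ for all $t\ge 2$ with $t\ge T_1$. 5. Suppose in addition that $f(X)=g(\mathcal{A}X)+\langle C,X\rangle$ on $\mathbb{S}^n$, where $\mathcal{A}:\mathbb{S}^n\to\mathbb{R}^p$ is linear with operator norm $\|\mathcal{A}\|$, $C\in\mathbb{S}^n$, and $g:\mathbb{R}^p\to\mathbb{R}$ is $\beta_g$-smooth and $\alpha_g$-strongly convex with $\alpha_g,\beta_g>0$. Then $f$ is $\|\mathcal{A}\|^2\beta_g$-smooth on $\mathcal{S}_n$; the bound on $T_0$ in 2 can be replaced with $T_0\le K\frac{\|\mathcal{A}\|^2\beta_g^2\,\beta}{\alpha_g\delta^2}$ (which is $K\frac{\|\mathcal{A}\|^4\beta_g^3}{\alpha_g\delta^2}$ if the algorithm is run with $\beta=\|\mathcal{A}\|^2\beta_g$); and the right-hand side in 3 can be replaced with $K\frac{\beta_g^2\|\mathcal{A}\|^2}{\alpha_g\delta^2}h_t$. -/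

import Mathlib

namespace SpectrahedronFW

/-- The subspace of symmetric matrices in the space of real `n × n` matrices. -/
def symSubmodule (n : ℕ) : Submodule ℝ (Matrix (Fin n) (Fin n) ℝ) where
  carrier := {A | A.IsSymm}
  add_mem' := fun hA hB => Matrix.IsSymm.add hA hB
  zero_mem' := Matrix.isSymm_zero
  smul_mem' := fun c _ hA => Matrix.IsSymm.smul hA c

/-- The space of real symmetric `n × n` matrices. It is made a Euclidean space below, with the
standard inner product, whose norm is the Frobenius norm. -/
def SymMat (n : ℕ) : Type := symSubmodule n

namespace SymMat

variable {n : ℕ}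

instance : AddCommGroup (SymMat n) := inferInstanceAs (AddCommGroup (symSubmodule n))

instance : Module ℝ (SymMat n) := inferInstanceAs (Module ℝ (symSubmodule n))

instance : FiniteDimensional ℝ (SymMat n) :=
  inferInstanceAs (FiniteDimensional ℝ (symSubmodule n))

/-- The underlying matrix. -/
def toMatrix : SymMat n →ₗ[ℝ] Matrix (Fin n) (Fin n) ℝ := (symSubmodule n).subtype

theorem toMatrix_injective : Function.Injective (toMatrix (n := n)) :=
  Subtype.val_injective

theorem isSymm (A : SymMat n) : (toMatrix A).IsSymm := A.2

theorem isHermitian (A : SymMat n) : (toMatrix A).IsHermitian := by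
  rw [Matrix.IsHermitian, Matrix.conjTranspose_eq_transpose_of_trivial]
  exact A.isSymm

/-- The standard inner product `⟨A, B⟩ = ∑ i j, A i j * B i j` (that is, `Tr (Aᵀ B)`). -/
@[reducible] noncomputable def innerCore : InnerProductSpace.Core ℝ (SymMat n) where
  inner A B := ∑ i, ∑ j, toMatrix A i j * toMatrix B i j
  conj_inner_symm A B := by simp [mul_comm]
  re_inner_nonneg A := by
    simpa using Finset.sum_nonneg fun i _ => Finset.sum_nonneg fun j _ =>
      mul_self_nonneg (toMatrix A i j)
  add_left A B D := by simp [add_mul, Finset.sum_add_distrib]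
  smul_left A B r := by simp [Finset.mul_sum, mul_assoc]
  definite A h := by
    apply toMatrix_injective
    ext i j
    have h1 := (Finset.sum_eq_zero_iff_of_nonneg fun i _ => Finset.sum_nonneg fun j _ =>
      mul_self_nonneg (toMatrix A i j)).1 h i (Finset.mem_univ i)
    have h2 := (Finset.sum_eq_zero_iff_of_nonneg fun j _ =>
      mul_self_nonneg (toMatrix A i j)).1 h1 j (Finset.mem_univ j)
    simpa using h2

noncomputable instance : NormedAddCommGroup (SymMat n) :=
  innerCore.toNormedAddCommGroup

noncomputable instance : InnerProductSpace ℝ (SymMat n) :=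
  InnerProductSpace.ofCore innerCore.toCore

noncomputable instance : CompleteSpace (SymMat n) := FiniteDimensional.complete ℝ (SymMat n)

theorem inner_def (A B : SymMat n) :
    inner ℝ A B = ∑ i, ∑ j, toMatrix A i j * toMatrix B i j := rfl

/-- The eigenvalues with multiplicity in non-increasing order. The index starts at `0`, so the
eigenvalue usually called `λ_k` is `A.eig ⟨k - 1, _⟩`. -/
noncomputable def eig (A : SymMat n) (i : Fin n) : ℝ :=
  A.isHermitian.eigenvalues₀ (Fin.cast (Fintype.card_fin n).symm i)

/-- `v` is a unit eigenvector of `A` that belongs to the largest eigenvalue `λ_1(A)`. -/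
def IsLeadingEV (hn : 2 ≤ n) (A : SymMat n) (v : EuclideanSpace ℝ (Fin n)) : Prop :=
  ‖v‖ = 1 ∧ (toMatrix A).mulVec v.ofLp = A.eig ⟨0, by omega⟩ • v.ofLp

/-- The eigen-gap `λ_{n-1}(A) - λ_n(A)` at the bottom of the spectrum. -/
noncomputable def bottomGap (hn : 2 ≤ n) (A : SymMat n) : ℝ :=
  A.eig ⟨n - 2, by omega⟩ - A.eig ⟨n - 1, by omega⟩

/-- The rank-one matrix `v vᵀ`. -/
def outer (v : EuclideanSpace ℝ (Fin n)) : SymMat n :=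
  ⟨Matrix.vecMulVec v.ofLp v.ofLp, by
    change (Matrix.vecMulVec v.ofLp v.ofLp).IsSymm
    ext i j
    simp [Matrix.vecMulVec_apply, mul_comm]⟩

end SymMat

open SymMat

/-- The spectrahedron: positive semidefinite matrices of trace one. -/
def spectrahedron (n : ℕ) : Set (SymMat n) :=
  {X | (toMatrix X).PosSemidef ∧ (toMatrix X).trace = 1}

/-- `f` is `β`-smooth on `S`: at the points of `S` it is differentiable (as a function on the
whole space), and its gradient is `β`-Lipschitz on `S`. -/
def IsSmoothOn {E : Type*} [NormedAddCommGroup E] [InnerProductSpace ℝ E] [CompleteSpace E]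
    (f : E → ℝ) (S : Set E) (β : ℝ) : Prop :=
  (∀ X ∈ S, DifferentiableAt ℝ f X) ∧
    ∀ X ∈ S, ∀ Y ∈ S, ‖gradient f X - gradient f Y‖ ≤ β * ‖X - Y‖

/-- The optimal value of `f` over the spectrahedron. -/
noncomputable def optVal {n : ℕ} (f : SymMat n → ℝ) : ℝ := sInf (f '' spectrahedron n)

/-- `Xs` minimizes `f` over the spectrahedron. -/
def IsOptimal {n : ℕ} (f : SymMat n → ℝ) (Xs : SymMat n) : Prop :=
  Xs ∈ spectrahedron n ∧ IsMinOn f (spectrahedron n) Xs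

/-- First step-size option: exact line search. -/
def LineSearch {n : ℕ} (f : SymMat n → ℝ) (X V : SymMat n) (η : ℝ) : Prop :=
  η ∈ Set.Icc (0 : ℝ) 1 ∧ IsMinOn (fun s : ℝ => f ((1 - s) • X + s • V)) (Set.Icc 0 1) η

/-- Second step-size option: minimization of the quadratic upper model. -/
def ModelSearch {n : ℕ} (f : SymMat n → ℝ) (β : ℝ) (X V : SymMat n) (η : ℝ) : Prop :=
  η ∈ Set.Icc (0 : ℝ) 1 ∧
    IsMinOn (fun s : ℝ => f X + s * inner ℝ (V - X) (gradient f X) + s ^ 2 * β / 2 * ‖X - V‖ ^ 2)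
      (Set.Icc 0 1) η

/-- The gradient step `Y = X - β⁻¹ ∇f(X)`. -/
noncomputable def gradStep {n : ℕ} (f : SymMat n → ℝ) (β : ℝ) (X : SymMat n) : SymMat n :=
  X - (1 / β) • gradient f X

/-- One iteration from `X` to `X'` of the method that mixes Frank-Wolfe and projected gradient. -/
def IsFWPGStep {n : ℕ} (hn : 2 ≤ n) (f : SymMat n → ℝ) (β : ℝ) (X X' : SymMat n) : Prop :=
  ((gradStep f β X).eig ⟨0, by omega⟩ ≥ 1 + (gradStep f β X).eig ⟨1, by omega⟩ ∧
      ∃ u, IsLeadingEV hn (gradStep f β X) u ∧ X' = outer u) ∨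
  (¬ (gradStep f β X).eig ⟨0, by omega⟩ ≥ 1 + (gradStep f β X).eig ⟨1, by omega⟩ ∧
      ∃ (v : EuclideanSpace ℝ (Fin n)) (η : ℝ), IsLeadingEV hn (-gradient f X) v ∧
        (LineSearch f X (outer v) η ∨ ModelSearch f β X (outer v) η) ∧
        X' = (1 - η) • X + η • outer v)

/-- `X 1, X 2, …` is a sequence of iterates of the method, started at an arbitrary point of the
spectrahedron. The value `X 0` is not used. -/
def IsFWPGSequence {n : ℕ} (hn : 2 ≤ n) (f : SymMat n → ℝ) (β : ℝ) (X : ℕ → SymMat n) : Prop :=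
  X 1 ∈ spectrahedron n ∧ ∀ t, 1 ≤ t → IsFWPGStep hn f β (X t) (X (t + 1))

/-- The structural assumption `f(X) = g(𝒜 X) + ⟨C, X⟩` with `g` smooth and strongly convex. -/
def HasStructure {n p : ℕ} (f : SymMat n → ℝ) (g : EuclideanSpace ℝ (Fin p) → ℝ)
    (A : SymMat n →L[ℝ] EuclideanSpace ℝ (Fin p)) (M : SymMat n) (βg αg : ℝ) : Prop :=
  0 < βg ∧ 0 < αg ∧ IsSmoothOn g Set.univ βg ∧ StrongConvexOn Set.univ αg g ∧
    ∀ X, f X = g (A X) + inner ℝ M X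

/-- From iteration `T` on, the error contracts by the factor `1 - min {δ/(12β), 1/2}`. -/
def ContractsFrom {n : ℕ} (f : SymMat n → ℝ) (β δ : ℝ) (X : ℕ → SymMat n) (T : ℕ) : Prop :=
  ∀ t, 1 ≤ t → T ≤ t →
    f (X (t + 1)) - optVal f ≤ (f (X t) - optVal f) * (1 - min (δ / (12 * β)) (1 / 2))

/-- At every iteration, each matrix `v vᵀ`, with `v` a leading unit eigenvector of `-∇f(X t)`,
has squared distance at most `K * (f(X t) - f*)` from `Xs`. -/
def EigenvectorBound {n : ℕ} (hn : 2 ≤ n) (f : SymMat n → ℝ) (X : ℕ → SymMat n) (Xs : SymMat n)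
    (K : ℝ) : Prop :=
  ∀ t, 1 ≤ t → ∀ v, IsLeadingEV hn (-gradient f (X t)) v →
    ‖outer v - Xs‖ ^ 2 ≤ K * (f (X t) - optVal f)

end SpectrahedronFW

/-! Spectral gaps are handled by one variational notion, `Dominates B u γ`: linear maximality of `u
uᵀ` over the spectrahedron with a margin `γ (1 - uᵀ Z u)`. The margin controls `‖Z - u uᵀ‖²`
(`norm_sub_outer_sq_le`), and it survives perturbation of `B` (`Dominates.le_eig_gap`).

Every step decreases `f` at least as much as the quadratic model does on the Frank-Wolfe segment
(`IsFWPGStep.le_model`): when the gap test succeeds, the projected gradient step is rank one and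
minimizes the model over the whole spectrahedron. The usual Frank-Wolfe induction then gives
`O(β/t)`.

If the gap `δ` at the minimizer is positive, the minimizer is some `u uᵀ`, and `‖X - u uᵀ‖² ≤ 2h/δ`.
Hence gradients converge to `∇f(u uᵀ)`. Once they are within `δ/3`, `-∇f(X)` has a gap of its own,
the Frank-Wolfe gap bounds the squared distance to the vertex, and the error contracts. Once `X` is
within `δ/(3β)` of `u uᵀ`, the gap test succeeds, so the next iterate has rank one. The `O(β/t)`
rate says when these radii are reached. The eigenvector bound is a Davis-Kahan estimate. Under the
structural assumption, strong convexity of `g` bounds the gradient error by `h` without using `δ`,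
which saves one power of `δ`. -/

namespace SpectrahedronFW

open SymMat

/-! ### Eigenvalues, the spectrahedron, and linear maximization with a margin. -/

section Spectral

variable {n : ℕ}

theorem inner_outer (A : SymMat n) (v : EuclideanSpace ℝ (Fin n)) :
    inner ℝ A (outer v) = v.ofLp ⬝ᵥ (toMatrix A).mulVec v.ofLp := by
  rw [inner_def]
  simp only [dotProduct, Matrix.mulVec, Finset.mul_sum]
  refine Finset.sum_congr rfl fun i _ => Finset.sum_congr rfl fun j _ => ?_
  change _ * (v.ofLp i * v.ofLp j) = _
  ring

theorem euclidean_inner_eq (v w : EuclideanSpace ℝ (Fin n)) :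
    inner ℝ v w = v.ofLp ⬝ᵥ w.ofLp := by
  simp [PiLp.inner_apply, dotProduct, mul_comm]

theorem outer_mulVec (v w : EuclideanSpace ℝ (Fin n)) :
    (toMatrix (outer v)).mulVec w.ofLp = (inner ℝ v w : ℝ) • v.ofLp := by
  change (Matrix.vecMulVec v.ofLp v.ofLp).mulVec w.ofLp = _
  rw [Matrix.vecMulVec_mulVec, euclidean_inner_eq]
  ext i
  simp [mul_comm]

theorem inner_outer_outer (v w : EuclideanSpace ℝ (Fin n)) :
    inner ℝ (outer v) (outer w) = (inner ℝ v w : ℝ) ^ 2 := by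
  rw [inner_outer, outer_mulVec, dotProduct_smul, ← euclidean_inner_eq, smul_eq_mul,
    real_inner_comm w v]
  ring

theorem inner_outer_self {v : EuclideanSpace ℝ (Fin n)} (hv : ‖v‖ = 1) :
    inner ℝ (outer v) (outer v) = (1 : ℝ) := by
  rw [inner_outer_outer, real_inner_self_eq_norm_sq, hv]
  norm_num

theorem outer_mem_spectrahedron {v : EuclideanSpace ℝ (Fin n)} (hv : ‖v‖ = 1) :
    outer v ∈ spectrahedron n := by
  refine ⟨?_, ?_⟩
  · have := Matrix.posSemidef_vecMulVec_self_star (R := ℝ) v.ofLp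
    rwa [star_trivial] at this
  · change (Matrix.vecMulVec v.ofLp v.ofLp).trace = 1
    rw [Matrix.trace_vecMulVec, ← euclidean_inner_eq, real_inner_self_eq_norm_sq, hv]
    norm_num

theorem inner_outer_nonneg {Z : SymMat n} (hZ : Z ∈ spectrahedron n)
    (v : EuclideanSpace ℝ (Fin n)) : 0 ≤ (inner ℝ Z (outer v) : ℝ) := by
  rw [inner_outer]
  simpa using hZ.1.dotProduct_mulVec_nonneg v.ofLp

theorem convex_spectrahedron : Convex ℝ (spectrahedron n) := by
  intro X hX Y hY a b ha hb hab
  refine ⟨?_, ?_⟩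
  · rw [map_add, map_smul, map_smul]
    exact (hX.1.smul ha).add (hY.1.smul hb)
  · rw [map_add, map_smul, map_smul, Matrix.trace_add, Matrix.trace_smul, Matrix.trace_smul,
      hX.2, hY.2]
    simpa using hab

theorem eig_antitone (A : SymMat n) : Antitone A.eig := fun _ _ h =>
  A.isHermitian.eigenvalues₀_antitone (Fin.le_def.2 (Fin.le_def.1 h))

theorem exists_eigenbasis (A : SymMat n) :
    ∃ b : OrthonormalBasis (Fin n) ℝ (EuclideanSpace ℝ (Fin n)),
      ∀ i, (toMatrix A).mulVec (b i).ofLp = A.eig i • (b i).ofLp := by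
  -- `eigenvalues` is `eigenvalues₀` transported along this equivalence; undoing it pairs the `i`-th
  -- basis vector with the sorted value `eig i`.
  set e : Fin (Fintype.card (Fin n)) ≃ Fin n := Fintype.equivOfCardEq (Fintype.card_fin _) with he
  refine ⟨A.isHermitian.eigenvectorBasis.reindex
    (e.symm.trans (finCongr (Fintype.card_fin n))), fun i => ?_⟩
  rw [OrthonormalBasis.reindex_apply, A.isHermitian.mulVec_eigenvectorBasis]
  congr 1
  simp [Matrix.IsHermitian.eigenvalues, eig, e]

theorem sum_basis_mul (b : OrthonormalBasis (Fin n) ℝ (EuclideanSpace ℝ (Fin n))) (i j : Fin n) :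
    ∑ k, (b k).ofLp i * (b k).ofLp j = if i = j then 1 else 0 := by
  have h := b.sum_inner_mul_inner (EuclideanSpace.single i (1 : ℝ)) (EuclideanSpace.single j 1)
  simpa [EuclideanSpace.inner_single_left, EuclideanSpace.inner_single_right,
    Pi.single_apply, eq_comm] using h

theorem sum_inner_outer_basis (Z : SymMat n)
    (b : OrthonormalBasis (Fin n) ℝ (EuclideanSpace ℝ (Fin n))) :
    ∑ k, inner ℝ Z (outer (b k)) = (toMatrix Z).trace := by
  simp only [inner_def]
  rw [Finset.sum_comm]
  refine Finset.sum_congr rfl fun i _ => ?_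
  rw [Finset.sum_comm]
  simp only [← Finset.mul_sum]
  have (j : Fin n) : ∑ k, toMatrix (outer (b k)) i j = if i = j then 1 else 0 :=
    sum_basis_mul b i j
  simp [this]

theorem eq_sum_eig_smul_outer {A : SymMat n} {μ : Fin n → ℝ}
    {b : OrthonormalBasis (Fin n) ℝ (EuclideanSpace ℝ (Fin n))}
    (hb : ∀ i, (toMatrix A).mulVec (b i).ofLp = μ i • (b i).ofLp) :
    A = ∑ k, μ k • outer (b k) := by
  apply toMatrix_injective
  ext i j
  have h1 : toMatrix A i j = ∑ l, toMatrix A i l * ∑ k, (b k).ofLp l * (b k).ofLp j := by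
    simp [sum_basis_mul]
  have h2 (k : Fin n) : ∑ l, toMatrix A i l * (b k).ofLp l = μ k * (b k).ofLp i := by
    simpa [Matrix.mulVec, dotProduct] using congrFun (hb k) i
  have h3 (k : Fin n) : toMatrix (outer (b k)) i j = (b k).ofLp i * (b k).ofLp j := rfl
  rw [h1, map_sum, Matrix.sum_apply]
  simp only [Finset.mul_sum]
  rw [Finset.sum_comm]
  refine Finset.sum_congr rfl fun k _ => ?_
  rw [map_smul, Matrix.smul_apply, smul_eq_mul, h3, ← mul_assoc, ← h2, Finset.sum_mul]
  exact Finset.sum_congr rfl fun l _ => by ring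

theorem inner_eq_sum_eig {A : SymMat n} {μ : Fin n → ℝ}
    {b : OrthonormalBasis (Fin n) ℝ (EuclideanSpace ℝ (Fin n))}
    (hb : ∀ i, (toMatrix A).mulVec (b i).ofLp = μ i • (b i).ofLp) (Z : SymMat n) :
    inner ℝ A Z = ∑ k, μ k * inner ℝ Z (outer (b k)) := by
  conv_lhs => rw [eq_sum_eig_smul_outer hb]
  rw [sum_inner]
  refine Finset.sum_congr rfl fun k _ => ?_
  rw [real_inner_smul_left, real_inner_comm]

theorem inner_outer_of_eigenvector {A : SymMat n} {c : ℝ} {v : EuclideanSpace ℝ (Fin n)}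
    (hv : ‖v‖ = 1) (h : (toMatrix A).mulVec v.ofLp = c • v.ofLp) :
    inner ℝ A (outer v) = c := by
  rw [inner_outer, h, dotProduct_smul, ← euclidean_inner_eq, real_inner_self_eq_norm_sq, hv]
  simp

theorem inner_nonneg_of_mem {X Y : SymMat n} (hX : X ∈ spectrahedron n)
    (hY : Y ∈ spectrahedron n) : 0 ≤ (inner ℝ X Y : ℝ) := by
  obtain ⟨b, hb⟩ := exists_eigenbasis X
  rw [inner_eq_sum_eig hb]
  refine Finset.sum_nonneg fun k _ => mul_nonneg ?_ (inner_outer_nonneg hY _)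
  rw [← inner_outer_of_eigenvector (b.norm_eq_one k) (hb k)]
  exact inner_outer_nonneg hX _

theorem inner_outer_le_one {Z : SymMat n} (hZ : Z ∈ spectrahedron n)
    (b : OrthonormalBasis (Fin n) ℝ (EuclideanSpace ℝ (Fin n))) (k : Fin n) :
    inner ℝ Z (outer (b k)) ≤ 1 := by
  rw [← hZ.2, ← sum_inner_outer_basis Z b]
  exact Finset.single_le_sum (f := fun k => (inner ℝ Z (outer (b k)) : ℝ))
    (fun i _ => inner_outer_nonneg hZ _) (Finset.mem_univ k)

theorem norm_sq_le_one {Z : SymMat n} (hZ : Z ∈ spectrahedron n) : ‖Z‖ ^ 2 ≤ 1 := by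
  obtain ⟨b, hb⟩ := exists_eigenbasis Z
  rw [← real_inner_self_eq_norm_sq, inner_eq_sum_eig hb, ← hZ.2, ← sum_inner_outer_basis Z b]
  refine Finset.sum_le_sum fun k _ => ?_
  rw [← inner_outer_of_eigenvector (b.norm_eq_one k) (hb k)]
  exact mul_le_of_le_one_left (inner_outer_nonneg hZ _) (inner_outer_le_one hZ b k)

theorem norm_sub_sq_le_two {X Y : SymMat n} (hX : X ∈ spectrahedron n)
    (hY : Y ∈ spectrahedron n) : ‖X - Y‖ ^ 2 ≤ 2 := by
  rw [norm_sub_sq_real]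
  linarith [norm_sq_le_one hX, norm_sq_le_one hY, inner_nonneg_of_mem hX hY]

theorem norm_sub_outer_sq_le {Z : SymMat n} (hZ : Z ∈ spectrahedron n)
    {u : EuclideanSpace ℝ (Fin n)} (hu : ‖u‖ = 1) :
    ‖Z - outer u‖ ^ 2 ≤ 2 * (1 - inner ℝ Z (outer u)) := by
  rw [norm_sub_sq_real]
  linarith [norm_sq_le_one hZ, norm_sq_le_one (outer_mem_spectrahedron hu)]

theorem rank_outer {v : EuclideanSpace ℝ (Fin n)} (hv : ‖v‖ = 1) :
    (toMatrix (outer v)).rank = 1 := by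
  have hv0 : v.ofLp ≠ 0 := by
    intro h
    have : v = 0 := by ext i; simp [h]
    simp [this] at hv
  apply le_antisymm
  · exact Matrix.rank_vecMulVec_le v.ofLp v.ofLp
  · rw [Nat.one_le_iff_ne_zero, Matrix.rank, Ne, Submodule.finrank_eq_zero]
    intro h
    have hmem : v.ofLp ∈ LinearMap.range (toMatrix (outer v)).mulVecLin :=
      ⟨v.ofLp, by rw [Matrix.mulVecLin_apply, outer_mulVec, real_inner_self_eq_norm_sq, hv]; simp⟩
    rw [h, Submodule.mem_bot] at hmem
    exact hv0 hmem

/-- `u uᵀ` maximizes `⟨B, ·⟩` over the spectrahedron, with margin `γ (1 - uᵀ Z u)` at `Z`. -/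
def Dominates (B : SymMat n) (u : EuclideanSpace ℝ (Fin n)) (γ : ℝ) : Prop :=
  ∀ Z ∈ spectrahedron n, γ * (1 - inner ℝ Z (outer u)) ≤ inner ℝ B (outer u - Z)

theorem dominates_of_basis {B : SymMat n} {μ : Fin n → ℝ}
    {b : OrthonormalBasis (Fin n) ℝ (EuclideanSpace ℝ (Fin n))}
    (hb : ∀ i, (toMatrix B).mulVec (b i).ofLp = μ i • (b i).ofLp) {γ : ℝ} {m : Fin n}
    (h : ∀ i, i ≠ m → γ ≤ μ m - μ i) : Dominates B (b m) γ := by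
  intro Z hZ
  rw [inner_sub_right, inner_outer_of_eigenvector (b.norm_eq_one m) (hb m), inner_eq_sum_eig hb]
  have h1 : ∑ k, inner ℝ Z (outer (b k)) = (1 : ℝ) := by rw [sum_inner_outer_basis, hZ.2]
  have h2 : γ * (∑ k, inner ℝ Z (outer (b k)) - inner ℝ Z (outer (b m)))
      ≤ ∑ k, (μ m - μ k) * inner ℝ Z (outer (b k)) := by
    rw [← Finset.sum_erase_eq_sub (Finset.mem_univ m), Finset.mul_sum,
      ← Finset.sum_erase Finset.univ (a := m) (by simp)]
    exact Finset.sum_le_sum fun k hk => mul_le_mul_of_nonneg_right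
      (h k (Finset.ne_of_mem_erase hk)) (inner_outer_nonneg hZ _)
  simp only [sub_mul, Finset.sum_sub_distrib, ← Finset.mul_sum, h1] at h2
  linarith

theorem exists_isLeadingEV (hn : 2 ≤ n) (B : SymMat n) : ∃ v, IsLeadingEV hn B v := by
  obtain ⟨b, hb⟩ := exists_eigenbasis B
  exact ⟨b ⟨0, by omega⟩, b.norm_eq_one _, hb _⟩

theorem eig_le_eig_one (hn : 2 ≤ n) (B : SymMat n) {i : Fin n} (hi : i ≠ ⟨0, by omega⟩) :
    B.eig i ≤ B.eig ⟨1, by omega⟩ := by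
  refine eig_antitone B (Fin.le_def.2 ?_)
  have : i.val ≠ 0 := fun h => hi (Fin.ext h)
  change 1 ≤ i.val
  omega

theorem SymMat.IsLeadingEV.dominates_zero {hn : 2 ≤ n} {B : SymMat n} {v : EuclideanSpace ℝ (Fin n)}
    (hv : IsLeadingEV hn B v) : Dominates B v 0 := by
  obtain ⟨b, hb⟩ := exists_eigenbasis B
  intro Z hZ
  have := dominates_of_basis hb (γ := 0) (m := ⟨0, by omega⟩) (fun i _ =>
    sub_nonneg.2 (eig_antitone B (Fin.le_def.2 (Nat.zero_le _)))) Z hZ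
  rw [inner_sub_right, inner_outer_of_eigenvector (b.norm_eq_one _) (hb _)] at this
  rw [inner_sub_right, inner_outer_of_eigenvector hv.1 hv.2]
  linarith

/-- The given `v` need not belong to the chosen eigenbasis. The positive margin, tested at `v vᵀ`,
forces `v vᵀ` to equal the projector of the first basis vector. -/
theorem SymMat.IsLeadingEV.dominates {hn : 2 ≤ n} {B : SymMat n} {v : EuclideanSpace ℝ (Fin n)}
    (hv : IsLeadingEV hn B v) {γ : ℝ} (hγ : 0 < γ)
    (h : γ ≤ B.eig ⟨0, by omega⟩ - B.eig ⟨1, by omega⟩) : Dominates B v γ := by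
  obtain ⟨b, hb⟩ := exists_eigenbasis B
  have hdom := dominates_of_basis hb (γ := γ) (m := ⟨0, by omega⟩) (fun i hi => by
    linarith [eig_le_eig_one hn B hi])
  have hV := outer_mem_spectrahedron hv.1
  have h1 := hdom _ hV
  rw [inner_sub_right, inner_outer_of_eigenvector (b.norm_eq_one _) (hb _),
    inner_outer_of_eigenvector hv.1 hv.2, sub_self] at h1
  have h2 := norm_sub_outer_sq_le hV (b.norm_eq_one ⟨0, by omega⟩)
  have h3 : outer v = outer (b ⟨0, by omega⟩) := by
    rw [← sub_eq_zero, ← norm_eq_zero]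
    have h4 := nonpos_of_mul_nonpos_right h1 hγ
    exact pow_eq_zero_iff two_ne_zero |>.1 (le_antisymm (by linarith) (sq_nonneg _))
  intro Z hZ
  rw [h3]
  exact hdom Z hZ

theorem exists_dominates_neg (hn : 2 ≤ n) (G : SymMat n) :
    ∃ u, ‖u‖ = 1 ∧ Dominates (-G) u (bottomGap hn G) := by
  obtain ⟨b, hb⟩ := exists_eigenbasis G
  have hb' (i) : (toMatrix (-G)).mulVec (b i).ofLp = (-G.eig i) • (b i).ofLp := by
    rw [map_neg, Matrix.neg_mulVec, hb, neg_smul]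
  refine ⟨b ⟨n - 1, by omega⟩, b.norm_eq_one _,
    dominates_of_basis hb' (μ := fun i => -G.eig i) fun i hi => ?_⟩
  have : G.eig ⟨n - 2, by omega⟩ ≤ G.eig i := by
    refine eig_antitone G (Fin.le_def.2 ?_)
    have h1 : i.val ≠ n - 1 := fun h => hi (Fin.ext h)
    have h2 := i.isLt
    change i.val ≤ n - 2
    omega
  simp only [bottomGap]
  linarith

/-- Margins at a common `u` add and scale; with `dominates_outer` this gives the margin `1 + δ/β`
for the gradient step taken at the minimizer. -/
theorem Dominates.add {B B' : SymMat n} {u : EuclideanSpace ℝ (Fin n)} {γ γ' : ℝ}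
    (h : Dominates B u γ) (h' : Dominates B' u γ') : Dominates (B + B') u (γ + γ') := by
  intro Z hZ
  rw [inner_add_left, add_mul]
  exact add_le_add (h Z hZ) (h' Z hZ)

theorem Dominates.smul {B : SymMat n} {u : EuclideanSpace ℝ (Fin n)} {γ c : ℝ} (hc : 0 ≤ c)
    (h : Dominates B u γ) : Dominates (c • B) u (c * γ) := by
  intro Z hZ
  rw [real_inner_smul_left, mul_assoc]
  exact mul_le_mul_of_nonneg_left (h Z hZ) hc

theorem dominates_outer {u : EuclideanSpace ℝ (Fin n)} (hu : ‖u‖ = 1) :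
    Dominates (outer u) u 1 := by
  intro Z _
  rw [inner_sub_right, inner_outer_self hu, real_inner_comm, one_mul]

theorem exists_unit_orthogonal (v w u : EuclideanSpace ℝ (Fin n)) (hv : ‖v‖ = 1) (hw : ‖w‖ = 1)
    (hvw : (inner ℝ v w : ℝ) = 0) :
    ∃ a b : ℝ, a ^ 2 + b ^ 2 = 1 ∧ ‖a • v + b • w‖ = 1 ∧ (inner ℝ (a • v + b • w) u : ℝ) = 0 := by
  have key (a b : ℝ) : ‖a • v + b • w‖ ^ 2 = a ^ 2 + b ^ 2 := by
    rw [norm_add_sq_real, norm_smul, norm_smul, real_inner_smul_left, real_inner_smul_right, hvw,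
      hv, hw, Real.norm_eq_abs, Real.norm_eq_abs, mul_one, mul_one, sq_abs, sq_abs]
    ring
  obtain ⟨a, b, hab, horth⟩ : ∃ a b : ℝ, a ^ 2 + b ^ 2 = 1 ∧
      a * (inner ℝ v u : ℝ) + b * (inner ℝ w u : ℝ) = 0 := by
    set p : ℝ := inner ℝ v u
    set q : ℝ := inner ℝ w u
    by_cases h0 : p ^ 2 + q ^ 2 = 0
    · have hp : p = 0 := by nlinarith [sq_nonneg p, sq_nonneg q]
      have hq : q = 0 := by nlinarith [sq_nonneg p, sq_nonneg q]
      exact ⟨1, 0, by norm_num, by simp [hp]⟩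
    · have hs : √(p ^ 2 + q ^ 2) ^ 2 = p ^ 2 + q ^ 2 := Real.sq_sqrt (by positivity)
      refine ⟨q / √(p ^ 2 + q ^ 2), -p / √(p ^ 2 + q ^ 2), ?_, by ring⟩
      rw [div_pow, div_pow, hs]
      field_simp
      ring
  refine ⟨a, b, hab, ?_, ?_⟩
  · have := key a b
    rw [hab] at this
    nlinarith [norm_nonneg (a • v + b • w)]
  · rw [inner_add_left, real_inner_smul_left, real_inner_smul_left, horth]

/-- The gap at the top of the spectrum survives perturbation. -/
theorem Dominates.le_eig_gap (hn : 2 ≤ n) {B : SymMat n} {u : EuclideanSpace ℝ (Fin n)} {γ : ℝ}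
    (hu : ‖u‖ = 1) (h : Dominates B u γ) (B' : SymMat n) :
    γ - 3 / 2 * ‖B' - B‖ ≤ B'.eig ⟨0, by omega⟩ - B'.eig ⟨1, by omega⟩ := by
  obtain ⟨b, hb⟩ := exists_eigenbasis B'
  set i0 : Fin n := ⟨0, by omega⟩
  set i1 : Fin n := ⟨1, by omega⟩
  have h01 : i0 ≠ i1 := by simp [i0, i1]
  -- Courant-Fischer: the span of the top two eigenvectors of `B'` contains a unit `w ⊥ u`. Then `λ₁
  -- ≥ ⟨B', u uᵀ⟩` and `λ₂ ≤ ⟨B', w wᵀ⟩`, while `B` separates the two projectors by the full `γ`.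
  obtain ⟨x, y, hxy, hw, hwu⟩ := exists_unit_orthogonal (b i0) (b i1) u (b.norm_eq_one _)
    (b.norm_eq_one _) (b.inner_eq_zero h01)
  set w := x • b i0 + y • b i1
  have hW := outer_mem_spectrahedron hw
  have hU := outer_mem_spectrahedron hu
  have hlead := SymMat.IsLeadingEV.dominates_zero (hn := hn) (B := B') ⟨b.norm_eq_one i0, hb i0⟩ _ hU
  rw [inner_sub_right, inner_outer_of_eigenvector (b.norm_eq_one _) (hb _)] at hlead
  have hBw : B'.eig i1 ≤ inner ℝ B' (outer w) := by
    rw [inner_outer]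
    have e1 : (toMatrix B').mulVec w.ofLp
        = (x • B'.eig i0 • b i0 + y • B'.eig i1 • b i1).ofLp := by
      simp only [w, WithLp.ofLp_add, WithLp.ofLp_smul, Matrix.mulVec_add, Matrix.mulVec_smul, hb]
    rw [e1, ← euclidean_inner_eq]
    simp only [w, inner_add_left, inner_add_right, real_inner_smul_left, real_inner_smul_right,
      b.inner_eq_zero h01, b.inner_eq_zero h01.symm, real_inner_self_eq_norm_sq, b.norm_eq_one]
    have : B'.eig i1 ≤ B'.eig i0 := eig_antitone B' (Fin.le_def.2 (Nat.zero_le _))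
    linear_combination mul_nonneg (sq_nonneg x) (sub_nonneg.2 this) - B'.eig i1 * hxy
  have hdom := h _ hW
  rw [inner_outer_outer, hwu] at hdom
  have hcs := abs_le.1 (abs_real_inner_le_norm (B' - B) (outer u - outer w))
  -- `3/2` is a rational bound for the diameter `√2`.
  have hn2 : ‖outer u - outer w‖ ≤ 3 / 2 := by
    nlinarith [norm_sub_sq_le_two hU hW, norm_nonneg (outer u - outer w)]
  rw [inner_sub_left, inner_sub_right B'] at hcs
  nlinarith [hcs.1, norm_nonneg (B' - B)]

end Spectral

/-! ### First-order inequalities for convex and smooth functions. -/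

section Gradient

/-- Only a derivative along the segment is asked for, so this serves both `f` and `g` minus a
quadratic. -/
theorem add_deriv_le_of_convexOn {E : Type*} [NormedAddCommGroup E] [NormedSpace ℝ E] {S : Set E}
    {f : E → ℝ} (hf : ConvexOn ℝ S f) {x y : E} (hx : x ∈ S) (hy : y ∈ S) {c : ℝ}
    (hc : HasDerivAt (fun t : ℝ => f (AffineMap.lineMap x y t)) c 0) : f x + c ≤ f y := by
  have h := (hf.comp_affineMap (AffineMap.lineMap x y : ℝ →ᵃ[ℝ] E)).le_slope_of_hasDerivAt
    (x := 0) (y := 1) (by simpa using hx) (by simpa using hy) one_pos hc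
  simp [slope_def_field] at h
  linarith

variable {E : Type*} [NormedAddCommGroup E] [InnerProductSpace ℝ E] [CompleteSpace E]

theorem hasDerivAt_comp_lineMap {f : E → ℝ} {x y : E} {s : ℝ}
    (hf : DifferentiableAt ℝ f (AffineMap.lineMap x y s)) :
    HasDerivAt (fun t : ℝ => f (AffineMap.lineMap x y t))
      (inner ℝ (gradient f (AffineMap.lineMap x y s)) (y - x)) s := by
  have h := hf.hasGradientAt.hasFDerivAt.comp_hasDerivAt s
    (AffineMap.hasDerivAt_lineMap (a := x) (b := y) (x := s))
  rwa [InnerProductSpace.toDual_apply_apply] at h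

theorem add_inner_gradient_le {S : Set E} {f : E → ℝ} (hf : ConvexOn ℝ S f) {x y : E}
    (hx : x ∈ S) (hy : y ∈ S) (hd : DifferentiableAt ℝ f x) :
    f x + inner ℝ (gradient f x) (y - x) ≤ f y := by
  refine add_deriv_le_of_convexOn hf hx hy ?_
  simpa using hasDerivAt_comp_lineMap (f := f) (x := x) (y := y) (s := 0) (by simpa using hd)

theorem add_inner_gradient_add_le {g : E → ℝ} {α : ℝ} (hg : StrongConvexOn Set.univ α g) (x y : E)
    (hd : DifferentiableAt ℝ g x) :
    g x + inner ℝ (gradient g x) (y - x) + α / 2 * ‖y - x‖ ^ 2 ≤ g y := by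
  have h1 := hasDerivAt_comp_lineMap (f := g) (x := x) (y := y) (s := 0) (by simpa using hd)
  have h2 := (AffineMap.hasDerivAt_lineMap (a := x) (b := y) (x := (0 : ℝ))).norm_sq
  have h := add_deriv_le_of_convexOn (strongConvexOn_iff_convex.1 hg) (Set.mem_univ x)
    (Set.mem_univ y) (h1.sub (h2.const_mul (α / 2)))
  simp only [AffineMap.lineMap_apply_zero] at h
  have h3 : ‖y - x‖ ^ 2 = ‖y‖ ^ 2 - 2 * inner ℝ x (y - x) - ‖x‖ ^ 2 := by
    rw [norm_sub_sq_real, inner_sub_right, real_inner_self_eq_norm_sq, real_inner_comm]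
    ring
  rw [h3]
  linarith

theorem IsSmoothOn.le_quadratic {S : Set E} {f : E → ℝ} {β : ℝ} (hf : IsSmoothOn f S β)
    (hS : Convex ℝ S) {x y : E} (hx : x ∈ S) (hy : y ∈ S) :
    f y ≤ f x + inner ℝ (gradient f x) (y - x) + β / 2 * ‖y - x‖ ^ 2 := by
  set c : ℝ → E := fun t => AffineMap.lineMap x y t
  have hmem : ∀ t ∈ Set.Icc (0 : ℝ) 1, c t ∈ S := fun t ht => hS.lineMap_mem hx hy ht
  set φ : ℝ → ℝ := fun t => f (c t) - t * inner ℝ (gradient f x) (y - x)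
    - β / 2 * ‖y - x‖ ^ 2 * t ^ 2
  have hφ : ∀ t ∈ Set.Icc (0 : ℝ) 1, HasDerivAt φ (inner ℝ (gradient f (c t)) (y - x)
      - 1 * inner ℝ (gradient f x) (y - x) - β / 2 * ‖y - x‖ ^ 2 * (2 * t)) t := by
    intro t ht
    have h := ((hasDerivAt_comp_lineMap (hf.1 _ (hmem t ht))).sub
      ((hasDerivAt_id t).mul_const (inner ℝ (gradient f x) (y - x) : ℝ))).sub
      ((hasDerivAt_pow 2 t).const_mul (β / 2 * ‖y - x‖ ^ 2))
    exact h.congr_deriv (by norm_num [c])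
  have hanti : AntitoneOn φ (Set.Icc 0 1) := by
    refine antitoneOn_of_deriv_nonpos (convex_Icc 0 1)
      (fun t ht => (hφ t ht).continuousAt.continuousWithinAt)
      (fun t ht => (hφ t (interior_subset ht)).differentiableAt.differentiableWithinAt)
      fun t ht => ?_
    have ht' := interior_subset ht
    rw [(hφ t ht').deriv, one_mul, ← inner_sub_left]
    have h1 := real_inner_le_norm (gradient f (c t) - gradient f x) (y - x)
    have h2 := hf.2 _ (hmem t ht') _ hx
    have h3 : ‖c t - x‖ = t * ‖y - x‖ := by
      have : c t - x = t • (y - x) := by simp [c, AffineMap.lineMap_apply_module']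
      rw [this, norm_smul, Real.norm_of_nonneg ht'.1]
    rw [h3] at h2
    have h4 := mul_le_mul_of_nonneg_right h2 (norm_nonneg (y - x))
    linarith
  have h := hanti (Set.left_mem_Icc.2 zero_le_one) (Set.right_mem_Icc.2 zero_le_one) zero_le_one
  simp only [φ, c, AffineMap.lineMap_apply_zero, AffineMap.lineMap_apply_one] at h
  linarith

theorem inner_gradient_nonneg_of_isMinOn {S : Set E} {f : E → ℝ} (hS : Convex ℝ S) {x y : E}
    (hx : x ∈ S) (hy : y ∈ S) (hmin : IsMinOn f S x) (hd : DifferentiableAt ℝ f x) :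
    0 ≤ (inner ℝ (gradient f x) (y - x) : ℝ) := by
  have h := hmin.localize.hasFDerivWithinAt_nonneg
    hd.hasGradientAt.hasFDerivAt.hasFDerivWithinAt
    (sub_mem_posTangentConeAt_of_segment_subset (hS.segment_subset hx hy))
  simpa using h

end Gradient

/-! ### Functions of the form `g(𝒜 X) + ⟨C, X⟩`. -/

section Structure

variable {n p : ℕ} {f : SymMat n → ℝ} {g : EuclideanSpace ℝ (Fin p) → ℝ}
  {A : SymMat n →L[ℝ] EuclideanSpace ℝ (Fin p)} {M : SymMat n} {βg αg : ℝ}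

theorem HasStructure.hasGradientAt (h : HasStructure f g A M βg αg) (X : SymMat n) :
    HasGradientAt f (A.adjoint (gradient g (A X)) + M) X := by
  have hfun : f = fun X => g (A X) + inner ℝ M X := funext h.2.2.2.2
  have hg := (h.2.2.1.1 (A X) (Set.mem_univ _)).hasGradientAt.hasFDerivAt.comp X A.hasFDerivAt
  have h2 := hg.add (innerSL ℝ M).hasFDerivAt
  rw [hasGradientAt_iff_hasFDerivAt, hfun]
  refine h2.congr_fderiv ?_
  ext D
  simp [ContinuousLinearMap.adjoint_inner_left]

theorem HasStructure.norm_gradient_sub_le (h : HasStructure f g A M βg αg) (X Y : SymMat n) :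
    ‖gradient f X - gradient f Y‖ ≤ ‖A‖ * (βg * ‖A (X - Y)‖) := by
  rw [(h.hasGradientAt X).gradient, (h.hasGradientAt Y).gradient, add_sub_add_right_eq_sub,
    ← map_sub, map_sub A X Y]
  refine (A.adjoint.le_opNorm _).trans ?_
  rw [LinearIsometryEquiv.norm_map]
  exact mul_le_mul_of_nonneg_left (h.2.2.1.2 _ (Set.mem_univ _) _ (Set.mem_univ _)) (norm_nonneg _)

theorem HasStructure.isSmoothOn (h : HasStructure f g A M βg αg) (S : Set (SymMat n)) :
    IsSmoothOn f S (‖A‖ ^ 2 * βg) := by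
  refine ⟨fun X _ => (h.hasGradientAt X).differentiableAt, fun X _ Y _ => ?_⟩
  calc _ ≤ ‖A‖ * (βg * ‖A (X - Y)‖) := h.norm_gradient_sub_le X Y
    _ ≤ ‖A‖ * (βg * (‖A‖ * ‖X - Y‖)) := by
      have := h.1
      gcongr
      exact A.le_opNorm _
    _ = _ := by ring

theorem HasStructure.add_inner_gradient_add_le (h : HasStructure f g A M βg αg)
    (X Y : SymMat n) :
    f X + inner ℝ (gradient f X) (Y - X) + αg / 2 * ‖A (Y - X)‖ ^ 2 ≤ f Y := by
  have h1 := SpectrahedronFW.add_inner_gradient_add_le h.2.2.2.1 (A X) (A Y)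
    (h.2.2.1.1 _ (Set.mem_univ _))
  rw [(h.hasGradientAt X).gradient, inner_add_left, ContinuousLinearMap.adjoint_inner_left,
    map_sub, h.2.2.2.2 X, h.2.2.2.2 Y, inner_sub_right M]
  linarith

theorem HasStructure.mul_norm_sq_le_inner (h : HasStructure f g A M βg αg)
    (X Y : SymMat n) :
    αg * ‖A (X - Y)‖ ^ 2 ≤ inner ℝ (gradient f X - gradient f Y) (X - Y) := by
  have h1 := h.add_inner_gradient_add_le X Y
  have h2 := h.add_inner_gradient_add_le Y X
  have h3 : ‖A (Y - X)‖ = ‖A (X - Y)‖ := by rw [← neg_sub, map_neg, norm_neg]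
  rw [h3, ← neg_sub X Y, inner_neg_right] at h1
  rw [inner_sub_left]
  linarith

end Structure

/-! ### One step of the method and the `O(β/t)` rate. -/

section Algorithm

variable {n : ℕ} {hn : 2 ≤ n} {f : SymMat n → ℝ} {β : ℝ}

theorem segment_mem {X V : SymMat n} (hX : X ∈ spectrahedron n) (hV : V ∈ spectrahedron n)
    {s : ℝ} (hs : s ∈ Set.Icc (0 : ℝ) 1) : (1 - s) • X + s • V ∈ spectrahedron n :=
  convex_spectrahedron hX hV (sub_nonneg.2 hs.2) hs.1 (by ring)

theorem IsSmoothOn.le_model (hf : IsSmoothOn f (spectrahedron n) β) {X V : SymMat n}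
    (hX : X ∈ spectrahedron n) (hV : V ∈ spectrahedron n) {s : ℝ} (hs : s ∈ Set.Icc (0 : ℝ) 1) :
    f ((1 - s) • X + s • V)
      ≤ f X + s * inner ℝ (V - X) (gradient f X) + s ^ 2 * β / 2 * ‖X - V‖ ^ 2 := by
  have h := hf.le_quadratic convex_spectrahedron hX (segment_mem hX hV hs)
  have e : (1 - s) • X + s • V - X = s • (V - X) := by module
  rw [e, real_inner_smul_right, real_inner_comm, norm_smul, mul_pow, Real.norm_eq_abs, sq_abs,
    norm_sub_rev V X] at h
  linarith

/-- If `u uᵀ` dominates the gradient step with margin `1`, then it is the projection of the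
gradient step to the spectrahedron, so it minimizes the quadratic upper model. -/
theorem model_le_of_dominates (hβ : 0 < β) {X Z : SymMat n} {u : EuclideanSpace ℝ (Fin n)}
    (hu : ‖u‖ = 1) (hdom : Dominates (gradStep f β X) u 1) (hZ : Z ∈ spectrahedron n) :
    inner ℝ (gradient f X) (outer u - X) + β / 2 * ‖outer u - X‖ ^ 2
      ≤ inner ℝ (gradient f X) (Z - X) + β / 2 * ‖Z - X‖ ^ 2 := by
  have h1 := hdom Z hZ
  set U := outer u
  set G := gradient f X
  have h2 : (inner ℝ U (U - Z) : ℝ) = 1 - inner ℝ Z U := by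
    rw [inner_sub_right, inner_outer_self hu, real_inner_comm]
  have h3 : β * inner ℝ (gradStep f β X) (U - Z)
      = β * inner ℝ X (U - Z) - inner ℝ G (U - Z) := by
    rw [gradStep, inner_sub_left, real_inner_smul_left]
    field_simp
    rfl
  -- Expanding around `U`, the model at `Z` minus the model at `U` is `β (⟨Y, U - Z⟩ - (1 - ⟨Z, U⟩))
  -- + β/2 ‖Z - U‖²`, where `Y` is the gradient step. Margin `1` makes the bracket nonnegative.
  have h4 : ‖Z - X‖ ^ 2 = ‖U - X‖ ^ 2 - 2 * (inner ℝ U (U - Z) - inner ℝ X (U - Z))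
      + ‖Z - U‖ ^ 2 := by
    have e : Z - X = (U - X) - (U - Z) := by abel
    rw [e, norm_sub_sq_real, inner_sub_left, norm_sub_rev U Z]
  have h5 : (inner ℝ G (Z - X) : ℝ) = inner ℝ G (U - X) - inner ℝ G (U - Z) := by
    rw [← inner_sub_right]
    congr 1
    abel
  rw [h4, h5, h2]
  have h6 := mul_le_mul_of_nonneg_left h1 hβ.le
  rw [h3] at h6
  have h7 := mul_nonneg hβ.le (sq_nonneg ‖Z - U‖)
  linarith

theorem IsFWPGStep.mem {X X' : SymMat n} (h : IsFWPGStep hn f β X X')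
    (hX : X ∈ spectrahedron n) : X' ∈ spectrahedron n := by
  rcases h with ⟨_, u, hu, rfl⟩ | ⟨_, v, η, hv, hη, rfl⟩
  · exact outer_mem_spectrahedron hu.1
  · exact segment_mem hX (outer_mem_spectrahedron hv.1) (hη.elim (·.1) (·.1))

/-- Every step of the method does at least as well as the quadratic upper model on the
Frank-Wolfe segment. -/
theorem IsFWPGStep.le_model {X X' : SymMat n} (h : IsFWPGStep hn f β X X') (hβ : 0 < β)
    (hf : IsSmoothOn f (spectrahedron n) β) (hX : X ∈ spectrahedron n) :
    ∃ v, IsLeadingEV hn (-gradient f X) v ∧ ∀ s ∈ Set.Icc (0 : ℝ) 1,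
      f X' ≤ f X + s * inner ℝ (outer v - X) (gradient f X)
        + s ^ 2 * β / 2 * ‖X - outer v‖ ^ 2 := by
  rcases h with ⟨hgap, u, hu, rfl⟩ | ⟨_, v, η, hv, hη, rfl⟩
  -- The algorithm computes no `v` in this branch; any leading `v` works, since the model is
  -- minimized over the whole spectrahedron.
  · obtain ⟨v, hv⟩ := exists_isLeadingEV hn (-gradient f X)
    refine ⟨v, hv, fun s hs => ?_⟩
    have hV := outer_mem_spectrahedron hv.1
    have h1 := hf.le_quadratic convex_spectrahedron hX (outer_mem_spectrahedron hu.1)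
    have h2 := model_le_of_dominates hβ hu.1 (hu.dominates one_pos (by linarith))
      (segment_mem hX hV hs)
    have e : (1 - s) • X + s • outer v - X = s • (outer v - X) := by module
    rw [e, real_inner_smul_right, norm_smul, mul_pow, Real.norm_eq_abs, sq_abs,
      norm_sub_rev (outer v) X] at h2
    rw [real_inner_comm]
    linarith
  · have hV := outer_mem_spectrahedron hv.1
    refine ⟨v, hv, fun s hs => ?_⟩
    rcases hη with hη | hη
    · exact (isMinOn_iff.1 hη.2 s hs).trans (hf.le_model hX hV hs)
    · exact (hf.le_model hX hV hη.1).trans (isMinOn_iff.1 hη.2 s hs)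

theorem IsFWPGSequence.mem {X : ℕ → SymMat n} (h : IsFWPGSequence hn f β X) {t : ℕ}
    (ht : 1 ≤ t) : X t ∈ spectrahedron n := by
  induction t, ht using Nat.le_induction with
  | base => exact h.1
  | succ t ht ih => exact (h.2 t ht).mem ih

theorem SymMat.IsLeadingEV.inner_gradient_le {X Z : SymMat n} {v : EuclideanSpace ℝ (Fin n)}
    (hv : IsLeadingEV hn (-gradient f X) v) (hZ : Z ∈ spectrahedron n) :
    inner ℝ (outer v - X) (gradient f X) ≤ inner ℝ (gradient f X) (Z - X) := by
  have h := hv.dominates_zero Z hZ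
  rw [zero_mul, inner_neg_left, inner_sub_right] at h
  rw [real_inner_comm, inner_sub_right, inner_sub_right]
  linarith

theorem IsFWPGStep.sub_le {X X' Z : SymMat n} (h : IsFWPGStep hn f β X X') (hβ : 0 < β)
    (hc : ConvexOn ℝ (spectrahedron n) f) (hf : IsSmoothOn f (spectrahedron n) β)
    (hX : X ∈ spectrahedron n) (hZ : Z ∈ spectrahedron n) {s : ℝ} (hs : s ∈ Set.Icc (0 : ℝ) 1) :
    f X' - f Z ≤ (1 - s) * (f X - f Z) + s ^ 2 * β := by
  obtain ⟨v, hv, hle⟩ := h.le_model hβ hf hX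
  have h1 := hle s hs
  have h2 := hv.inner_gradient_le hZ
  have h3 := add_inner_gradient_le hc hX hZ (hf.1 X hX)
  have h4 := norm_sub_sq_le_two hX (outer_mem_spectrahedron hv.1)
  have h5 : s * inner ℝ (outer v - X) (gradient f X) ≤ s * (f Z - f X) :=
    mul_le_mul_of_nonneg_left (by linarith) hs.1
  have h6 : s ^ 2 * β / 2 * ‖X - outer v‖ ^ 2 ≤ s ^ 2 * β / 2 * 2 :=
    mul_le_mul_of_nonneg_left h4 (by positivity)
  linarith

theorem IsFWPGSequence.sub_le_div {X : ℕ → SymMat n} (h : IsFWPGSequence hn f β X) (hβ : 0 < β)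
    (hc : ConvexOn ℝ (spectrahedron n) f) (hf : IsSmoothOn f (spectrahedron n) β)
    {Z : SymMat n} (hZ : Z ∈ spectrahedron n) {t : ℕ} (ht : 2 ≤ t) :
    f (X t) - f Z ≤ 4 * (β / t) := by
  induction t, ht using Nat.le_induction with
  | base =>
    have := (h.2 1 le_rfl).sub_le hβ hc hf (h.mem le_rfl) hZ (s := 1) (by simp)
    norm_num at this ⊢
    linarith
  | succ t ht ih =>
    have ht' : (2 : ℝ) ≤ t := by exact_mod_cast ht
    -- The step `2/t` is admissible from `t = 2` on. The base case uses the full step `s = 1`, which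
    -- removes the dependence on the starting point.
    have hs : 2 / (t : ℝ) ∈ Set.Icc (0 : ℝ) 1 :=
      ⟨by positivity, (div_le_one (by linarith)).2 ht'⟩
    have h1 := (h.2 t (by omega)).sub_le hβ hc hf (h.mem (by omega)) hZ hs
    have h2 := mul_le_mul_of_nonneg_left ih (sub_nonneg.2 hs.2)
    refine (h1.trans (add_le_add_left h2 _)).trans ?_
    push_cast
    have h3 : (1 - 2 / (t : ℝ)) * (4 * (β / t)) + (2 / (t : ℝ)) ^ 2 * β
        = 4 * (β * ((t - 1) / t ^ 2)) := by
      field_simp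
      ring
    have h4 : ((t : ℝ) - 1) / t ^ 2 ≤ 1 / (t + 1) := by
      rw [div_le_div_iff₀ (by positivity) (by positivity)]
      linarith
    rw [h3, div_eq_mul_one_div β]
    have := mul_le_mul_of_nonneg_left h4 hβ.le
    linarith

end Algorithm

/-! ### Consequences of a positive gap at the minimizer. -/

section Gap

variable {n : ℕ} {hn : 2 ≤ n} {f : SymMat n → ℝ} {β δ : ℝ} {Xs : SymMat n}

theorem IsOptimal.optVal_eq (h : IsOptimal f Xs) : optVal f = f Xs :=
  IsLeast.csInf_eq ⟨Set.mem_image_of_mem f h.1, by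
    rintro _ ⟨Z, hZ, rfl⟩
    exact isMinOn_iff.1 h.2 Z hZ⟩

/-- With a positive gap the minimizer has rank one. -/
theorem IsOptimal.exists_eq_outer (h : IsOptimal f Xs) (hd : DifferentiableAt ℝ f Xs)
    (hgap : 0 < bottomGap hn (gradient f Xs)) :
    ∃ u, ‖u‖ = 1 ∧ Xs = outer u ∧
      Dominates (-gradient f Xs) u (bottomGap hn (gradient f Xs)) := by
  obtain ⟨u, hu, hdom⟩ := exists_dominates_neg hn (gradient f Xs)
  refine ⟨u, hu, ?_, hdom⟩
  have h1 := hdom Xs h.1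
  have h2 := inner_gradient_nonneg_of_isMinOn convex_spectrahedron h.1
    (outer_mem_spectrahedron hu) h.2 hd
  rw [inner_neg_left] at h1
  have h3 := nonpos_of_mul_nonpos_right (h1.trans (by linarith)) hgap
  have h4 := norm_sub_outer_sq_le h.1 hu
  rw [← sub_eq_zero, ← norm_eq_zero]
  exact pow_eq_zero_iff two_ne_zero |>.1 (le_antisymm (by linarith) (sq_nonneg _))

theorem Dominates.le_inner_gradient {u : EuclideanSpace ℝ (Fin n)} {G X : SymMat n}
    (hu : ‖u‖ = 1) (hdom : Dominates (-G) u δ) (hδ : 0 ≤ δ) (hX : X ∈ spectrahedron n) :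
    δ / 2 * ‖X - outer u‖ ^ 2 ≤ inner ℝ G (X - outer u) := by
  have h1 := hdom X hX
  have h2 := mul_le_mul_of_nonneg_left (norm_sub_outer_sq_le hX hu) hδ
  rw [inner_neg_left, ← inner_neg_right, neg_sub] at h1
  linarith

/-- Quadratic growth: the margin bounds the linear part of `f` at the minimizer from below, and
convexity bounds `f` by that linear part. -/
theorem norm_sub_sq_le_of_dominates {u : EuclideanSpace ℝ (Fin n)}
    (hc : ConvexOn ℝ (spectrahedron n) f) (hd : DifferentiableAt ℝ f (outer u)) (hu : ‖u‖ = 1)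
    (hdom : Dominates (-gradient f (outer u)) u δ) (hδ : 0 < δ) {X : SymMat n}
    (hX : X ∈ spectrahedron n) :
    ‖X - outer u‖ ^ 2 ≤ 2 * (f X - f (outer u)) / δ := by
  have h1 := hdom.le_inner_gradient hu hδ.le hX
  have h2 := add_inner_gradient_le hc (outer_mem_spectrahedron hu) hX hd
  rw [le_div_iff₀ hδ]
  linarith

/-- Davis-Kahan: add the margin of `u` for `-G'` to the maximality of `v` for `-G` and apply
Cauchy-Schwarz. No gap of `G` is needed. -/
theorem SymMat.IsLeadingEV.norm_outer_sub_sq_le {u v : EuclideanSpace ℝ (Fin n)} {G G' : SymMat n}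
    (hv : IsLeadingEV hn (-G) v) (hu : ‖u‖ = 1) (hdom : Dominates (-G') u δ) (hδ : 0 < δ) :
    ‖outer v - outer u‖ ^ 2 ≤ 4 / δ ^ 2 * ‖G - G'‖ ^ 2 := by
  have h1 := hdom.le_inner_gradient hu hδ.le (outer_mem_spectrahedron hv.1)
  have h2 := hv.dominates_zero _ (outer_mem_spectrahedron hu)
  rw [zero_mul, inner_neg_left] at h2
  have h3 := abs_le.1 (abs_real_inner_le_norm (G - G') (outer v - outer u))
  rw [inner_sub_left] at h3
  have h4 : δ * ‖outer v - outer u‖ ≤ 2 * ‖G - G'‖ := by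
    by_contra! hlt
    have hpos : 0 < ‖outer v - outer u‖ := by
      by_contra! h0
      have := le_antisymm h0 (norm_nonneg _)
      rw [this, mul_zero] at hlt
      linarith [norm_nonneg (G - G')]
    have := mul_lt_mul_of_pos_right hlt hpos
    linarith
  have h5 : ‖outer v - outer u‖ ≤ 2 * ‖G - G'‖ / δ := by
    rw [le_div_iff₀ hδ]
    linarith
  calc ‖outer v - outer u‖ ^ 2 ≤ (2 * ‖G - G'‖ / δ) ^ 2 := by gcongr
    _ = _ := by ring

/-- Here `q` is the Frank-Wolfe gap and `D` the squared distance to the vertex. With `s = min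
(δ/(6β)) 1` the quadratic term eats at most half of the gain `s q`, and `q ≥ h`. -/
theorem contraction_of_quadratic {h h' q D : ℝ} (hβ : 0 < β) (hδ : 0 < δ) (hh : 0 ≤ h)
    (hq : h ≤ q) (hD : δ / 6 * D ≤ q)
    (hle : ∀ s ∈ Set.Icc (0 : ℝ) 1, h' ≤ h - s * q + s ^ 2 * β / 2 * D) :
    h' ≤ h * (1 - min (δ / (12 * β)) (1 / 2)) := by
  have hq0 : 0 ≤ q := hh.trans hq
  have hD' : D ≤ 6 * q / δ := by
    rw [le_div_iff₀ hδ]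
    linarith
  rcases le_total δ (6 * β) with hle' | hle'
  · have h1 := hle (δ / (6 * β)) ⟨by positivity, (div_le_one (by positivity)).2 hle'⟩
    have h2 : (δ / (6 * β)) ^ 2 * β / 2 * D ≤ (δ / (6 * β)) ^ 2 * β / 2 * (6 * q / δ) :=
      mul_le_mul_of_nonneg_left hD' (by positivity)
    have h3 : (δ / (6 * β)) ^ 2 * β / 2 * (6 * q / δ) = δ / (12 * β) * q := by
      field_simp
      ring
    have h4 : δ / (6 * β) * q = 2 * (δ / (12 * β) * q) := by
      field_simp
      ring
    have h5 : δ / (12 * β) * h ≤ δ / (12 * β) * q := mul_le_mul_of_nonneg_left hq (by positivity)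
    have h6 := mul_le_mul_of_nonneg_left (min_le_left (δ / (12 * β)) (1 / 2)) hh
    linarith
  · have h1 := hle 1 (by simp)
    have h2 : β / 2 * D ≤ q / 2 := by
      rcases le_total D 0 with h0 | h0
      · exact (mul_nonpos_of_nonneg_of_nonpos (by positivity) h0).trans (by positivity)
      · nlinarith
    have h6 := mul_le_mul_of_nonneg_left (min_le_right (δ / (12 * β)) (1 / 2)) hh
    linarith

theorem IsFWPGStep.contraction {X X' : SymMat n} {u : EuclideanSpace ℝ (Fin n)}
    (h : IsFWPGStep hn f β X X') (hβ : 0 < β) (hc : ConvexOn ℝ (spectrahedron n) f)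
    (hf : IsSmoothOn f (spectrahedron n) β) (hX : X ∈ spectrahedron n) (hu : ‖u‖ = 1)
    (hopt : IsOptimal f (outer u)) (hdom : Dominates (-gradient f (outer u)) u δ) (hδ : 0 < δ)
    (hclose : ‖gradient f X - gradient f (outer u)‖ ≤ δ / 3) :
    f X' - f (outer u) ≤ (f X - f (outer u)) * (1 - min (δ / (12 * β)) (1 / 2)) := by
  obtain ⟨v, hv, hle⟩ := h.le_model hβ hf hX
  have hV := outer_mem_spectrahedron hv.1
  have hU := outer_mem_spectrahedron hu
  have hgap := hdom.le_eig_gap hn hu (-gradient f X)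
  rw [neg_sub_neg, norm_sub_rev] at hgap
  -- Perturbation leaves a gap of at least `δ - (3/2)(δ/3) = δ/2`; `δ/3` suffices for the constant
  -- `12`.
  have hdv : Dominates (-gradient f X) v (δ / 3) := hv.dominates (by positivity) (by linarith)
  have h1 := hdv.le_inner_gradient hv.1 (by positivity) hX
  have h2 := hv.inner_gradient_le hU
  have h3 := add_inner_gradient_le hc hX hU (hf.1 X hX)
  have h4 : (inner ℝ (outer v - X) (gradient f X) : ℝ)
      = -inner ℝ (gradient f X) (X - outer v) := by
    rw [real_inner_comm, ← inner_neg_right, neg_sub]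
  refine contraction_of_quadratic (q := inner ℝ (gradient f X) (X - outer v))
    (D := ‖X - outer v‖ ^ 2) hβ hδ (sub_nonneg.2 (isMinOn_iff.1 hopt.2 X hX)) (by linarith)
    (by linarith) fun s hs => ?_
  have h5 := hle s hs
  rw [h4] at h5
  linarith

/-- The gradient map is `2`-Lipschitz, so the gap `1 + δ/β` at the minimizer drops by at most `(3/2)
· 2 · δ/(3β) = δ/β`. The gap test therefore succeeds. -/
theorem IsFWPGStep.rank_eq_one {X X' : SymMat n} {u : EuclideanSpace ℝ (Fin n)}
    (h : IsFWPGStep hn f β X X') (hβ : 0 < β)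
    (hf : IsSmoothOn f (spectrahedron n) β) (hX : X ∈ spectrahedron n) (hu : ‖u‖ = 1)
    (hdom : Dominates (-gradient f (outer u)) u δ) (hclose : ‖X - outer u‖ ≤ δ / (3 * β)) :
    (toMatrix X').rank = 1 := by
  have hdom' := (dominates_outer hu).add (hdom.smul (c := 1 / β) (by positivity))
  have hgap := hdom'.le_eig_gap hn hu (gradStep f β X)
  have hnorm : ‖gradStep f β X - (outer u + (1 / β) • -gradient f (outer u))‖
      ≤ 2 * ‖X - outer u‖ := by
    have e : gradStep f β X - (outer u + (1 / β) • -gradient f (outer u))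
        = (X - outer u) - (1 / β) • (gradient f X - gradient f (outer u)) := by
      rw [gradStep]
      module
    rw [e]
    refine (norm_sub_le _ _).trans ?_
    rw [norm_smul, Real.norm_of_nonneg (by positivity)]
    have h1 := mul_le_mul_of_nonneg_left (hf.2 X hX _ (outer_mem_spectrahedron hu))
      (by positivity : 0 ≤ 1 / β)
    have h2 : 1 / β * (β * ‖X - outer u‖) = ‖X - outer u‖ := by field_simp
    linarith
  have h3 : δ / (3 * β) = 1 / 3 * (1 / β * δ) := by
    field_simp
  rw [h3] at hclose
  rcases h with ⟨_, w, hw, rfl⟩ | ⟨hno, _⟩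
  · exact rank_outer hw.1
  · exact absurd (by linarith) hno

end Gap

/-! ### From rates to iteration thresholds. -/

/-- The bound `T ≤ x` has no additive constant, so small `x` needs a property valid from the start.
For larger `x`, `T = ⌊x⌋` is at least `3`, so that `t - 1 ≥ 2` too and the rate applies to the
previous iterate. -/
theorem exists_threshold {P : ℕ → Prop} {x : ℝ} (hx : 0 ≤ x) (hsmall : x < 3 → ∀ t, 1 ≤ t → P t)
    (hlarge : ∀ t : ℕ, 3 ≤ t → x ≤ 2 * t → P t) :
    ∃ T : ℕ, (T : ℝ) ≤ x ∧ ∀ t, 1 ≤ t → T ≤ t → P t := by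
  rcases lt_or_ge x 3 with h | h
  · exact ⟨0, by simpa using hx, fun t ht _ => hsmall h t ht⟩
  · refine ⟨⌊x⌋₊, Nat.floor_le hx, fun t ht hT => hlarge t ?_ ?_⟩
    · exact (Nat.le_floor (by exact_mod_cast h)).trans hT
    · have h1 := Nat.lt_floor_add_one x
      have h2 : (⌊x⌋₊ : ℝ) ≤ t := by exact_mod_cast hT
      have h3 : (1 : ℝ) ≤ t := by exact_mod_cast ht
      linarith

section Threshold

variable {n : ℕ} {hn : 2 ≤ n} {f : SymMat n → ℝ} {β δ : ℝ} {X : ℕ → SymMat n}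
  {u : EuclideanSpace ℝ (Fin n)}

/-- If the squared distance of the gradients from the one at the minimizer is small at the start
and controlled by the error later on, then the error contracts from some iteration on. -/
theorem IsFWPGSequence.exists_contractsFrom (h : IsFWPGSequence hn f β X) (hβ : 0 < β)
    (hc : ConvexOn ℝ (spectrahedron n) f) (hf : IsSmoothOn f (spectrahedron n) β) (hu : ‖u‖ = 1)
    (hopt : IsOptimal f (outer u)) (hdom : Dominates (-gradient f (outer u)) u δ) (hδ : 0 < δ)
    {c R : ℝ} (hR : 0 ≤ R) (hcR : c * β ≤ 2 * R * δ ^ 2) (hc0 : 0 ≤ c)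
    (hsmall : 1000 * R < 3 → ∀ Z ∈ spectrahedron n,
      ‖gradient f Z - gradient f (outer u)‖ ^ 2 ≤ δ ^ 2 / 9)
    (hgrad : ∀ Z ∈ spectrahedron n,
      ‖gradient f Z - gradient f (outer u)‖ ^ 2 ≤ c * (f Z - f (outer u))) :
    ∃ T₀ : ℕ, (T₀ : ℝ) ≤ 1000 * R ∧ ContractsFrom f β δ X T₀ := by
  have key : ∀ t, 1 ≤ t → ‖gradient f (X t) - gradient f (outer u)‖ ^ 2 ≤ δ ^ 2 / 9 →
      f (X (t + 1)) - optVal f ≤ (f (X t) - optVal f) * (1 - min (δ / (12 * β)) (1 / 2)) := by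
    intro t ht hle
    rw [hopt.optVal_eq]
    refine (h.2 t ht).contraction hβ hc hf (h.mem ht) hu hopt hdom hδ ?_
    refine le_of_sq_le_sq ?_ (by positivity)
    linarith [show (δ / 3) ^ 2 = δ ^ 2 / 9 by ring]
  refine exists_threshold (by positivity) (fun hx t ht => key t ht (hsmall hx _ (h.mem ht)))
    fun t ht hx => key t (by omega) ?_
  have ht0 : (0 : ℝ) < t := by exact_mod_cast (by omega : 0 < t)
  refine (hgrad _ (h.mem (by omega))).trans ?_
  have h1 := mul_le_mul_of_nonneg_left (h.sub_le_div hβ hc hf hopt.1 (by omega : 2 ≤ t)) hc0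
  refine h1.trans ?_
  have h2 : c * (4 * (β / t)) = 4 * (c * β) / t := by ring
  rw [h2, div_le_iff₀ ht0]
  have h3 := mul_le_mul_of_nonneg_right hx (sq_nonneg δ)
  have h4 := mul_nonneg hR (sq_nonneg δ)
  linarith

theorem IsFWPGSequence.exists_rank_eq_one (h : IsFWPGSequence hn f β X) (hβ : 0 < β)
    (hc : ConvexOn ℝ (spectrahedron n) f) (hf : IsSmoothOn f (spectrahedron n) β) (hu : ‖u‖ = 1)
    (hopt : IsOptimal f (outer u)) (hdom : Dominates (-gradient f (outer u)) u δ) (hδ : 0 < δ)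
    (hsmall : 1000 * (β / δ) ^ 3 < 3 → β ^ 2 * 18 ≤ δ ^ 2) :
    ∃ T₁ : ℕ, (T₁ : ℝ) ≤ 1000 * (β / δ) ^ 3 ∧
      ∀ t : ℕ, 2 ≤ t → T₁ ≤ t → (toMatrix (X t)).rank = 1 := by
  have key : ∀ t, 1 ≤ t → ‖X t - outer u‖ ^ 2 * (9 * β ^ 2) ≤ δ ^ 2 →
      (toMatrix (X (t + 1))).rank = 1 := by
    intro t ht hle
    refine (h.2 t ht).rank_eq_one hβ hf (h.mem ht) hu hdom ?_
    rw [le_div_iff₀ (by positivity)]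
    refine le_of_sq_le_sq ?_ hδ.le
    linarith [show (‖X t - outer u‖ * (3 * β)) ^ 2 = ‖X t - outer u‖ ^ 2 * (9 * β ^ 2) by ring]
  have hpos : 0 < (β / δ) ^ 3 := by positivity
  obtain ⟨T, hT, hT2⟩ := exists_threshold
    (P := fun t => 2 ≤ t → (toMatrix (X t)).rank = 1) (x := 1000 * (β / δ) ^ 3) (by positivity)
    (fun hx t _ ht => by
      obtain ⟨s, rfl⟩ : ∃ s, t = s + 1 := ⟨t - 1, by omega⟩
      have h1 := norm_sub_sq_le_two (h.mem (by omega : 1 ≤ s)) hopt.1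
      exact key s (by omega) ((mul_le_mul_of_nonneg_right h1 (by positivity)).trans
        (by linarith [hsmall hx])))
    (fun t ht hx _ => by
      obtain ⟨s, rfl⟩ : ∃ s, t = s + 1 := ⟨t - 1, by omega⟩
      have hs : (2 : ℝ) ≤ s := by exact_mod_cast (by omega : 2 ≤ s)
      have h1 := norm_sub_sq_le_of_dominates hc (hf.1 _ hopt.1) hu hdom hδ
        (h.mem (by omega : 1 ≤ s))
      have h2 := h.sub_le_div hβ hc hf hopt.1 (by omega : 2 ≤ s)
      refine key s (by omega) ?_
      have h3 : 2 * (f (X s) - f (outer u)) / δ ≤ 2 * (4 * (β / s)) / δ := by gcongr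
      refine (mul_le_mul_of_nonneg_right (h1.trans h3) (by positivity)).trans ?_
      push_cast at hx
      have h4 : 2 * (4 * (β / s)) / δ * (9 * β ^ 2) = 72 * (β / δ) ^ 3 * δ ^ 2 / s := by
        field_simp
        ring
      rw [h4, div_le_iff₀ (by linarith), mul_comm (δ ^ 2)]
      exact mul_le_mul_of_nonneg_right (by linarith) (sq_nonneg δ))
  exact ⟨T, hT, fun t ht hTt => hT2 t (by omega) hTt ht⟩

theorem eigenvectorBound_of_gradient (h : IsFWPGSequence hn f β X) (hu : ‖u‖ = 1)
    (hopt : IsOptimal f (outer u)) (hdom : Dominates (-gradient f (outer u)) u δ) (hδ : 0 < δ)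
    {c K : ℝ} (hcK : 4 / δ ^ 2 * c ≤ K)
    (hgrad : ∀ Z ∈ spectrahedron n,
      ‖gradient f Z - gradient f (outer u)‖ ^ 2 ≤ c * (f Z - f (outer u))) :
    EigenvectorBound hn f X (outer u) K := by
  intro t ht v hv
  rw [hopt.optVal_eq]
  have hX := h.mem ht
  have h0 : 0 ≤ f (X t) - f (outer u) := sub_nonneg.2 (isMinOn_iff.1 hopt.2 _ hX)
  calc _ ≤ 4 / δ ^ 2 * ‖gradient f (X t) - gradient f (outer u)‖ ^ 2 :=
        hv.norm_outer_sub_sq_le hu hdom hδ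
    _ ≤ 4 / δ ^ 2 * (c * (f (X t) - f (outer u))) :=
        mul_le_mul_of_nonneg_left (hgrad _ hX) (by positivity)
    _ = 4 / δ ^ 2 * c * (f (X t) - f (outer u)) := by ring
    _ ≤ _ := mul_le_mul_of_nonneg_right hcK h0

/-- The factor `αg * ‖A (Z - W)‖ ^ 2` is kept apart because it is what strong convexity bounds. -/
theorem HasStructure.norm_gradient_sub_sq_le {p : ℕ} {g : EuclideanSpace ℝ (Fin p) → ℝ}
    {A : SymMat n →L[ℝ] EuclideanSpace ℝ (Fin p)} {M : SymMat n} {βg αg : ℝ}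
    (h : HasStructure f g A M βg αg) (Z W : SymMat n) :
    ‖gradient f Z - gradient f W‖ ^ 2
      ≤ ‖A‖ ^ 2 * βg ^ 2 / αg * (αg * ‖A (Z - W)‖ ^ 2) := by
  have hα := h.2.1
  calc _ ≤ (‖A‖ * (βg * ‖A (Z - W)‖)) ^ 2 := by
        gcongr
        exact h.norm_gradient_sub_le Z W
    _ = _ := by
        field_simp

end Threshold

end SpectrahedronFW

/-! ### Assembly of the five claims. -/

theorem mainTheorem4 :
    ∃ K : ℝ, 0 < K ∧
      ∀ (n : ℕ) (hn : 2 ≤ n) (f : SpectrahedronFW.SymMat n → ℝ) (β : ℝ)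
        (X : ℕ → SpectrahedronFW.SymMat n),
        0 < β →
        ConvexOn ℝ (SpectrahedronFW.spectrahedron n) f →
        SpectrahedronFW.IsSmoothOn f (SpectrahedronFW.spectrahedron n) β →
        SpectrahedronFW.IsFWPGSequence hn f β X →
        (∀ t : ℕ, 2 ≤ t → f (X t) - SpectrahedronFW.optVal f ≤ K * (β / t)) ∧
        ∀ (Xs : SpectrahedronFW.SymMat n) (δ : ℝ),
          SpectrahedronFW.IsOptimal f Xs →
          δ = SpectrahedronFW.SymMat.bottomGap hn (gradient f Xs) →
          0 < δ →
          (∃ T₀ : ℕ, (T₀ : ℝ) ≤ K * (β / δ) ^ 3 ∧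
            SpectrahedronFW.ContractsFrom f β δ X T₀) ∧
          SpectrahedronFW.EigenvectorBound hn f X Xs (K * (β ^ 2 / δ ^ 3)) ∧
          (∃ T₁ : ℕ, (T₁ : ℝ) ≤ K * (β / δ) ^ 3 ∧
            ∀ t : ℕ, 2 ≤ t → T₁ ≤ t → (SpectrahedronFW.SymMat.toMatrix (X t)).rank = 1) ∧
          ∀ (p : ℕ) (g : EuclideanSpace ℝ (Fin p) → ℝ)
            (A : SpectrahedronFW.SymMat n →L[ℝ] EuclideanSpace ℝ (Fin p))
            (M : SpectrahedronFW.SymMat n) (βg αg : ℝ),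
            SpectrahedronFW.HasStructure f g A M βg αg →
            SpectrahedronFW.IsSmoothOn f (SpectrahedronFW.spectrahedron n) (‖A‖ ^ 2 * βg) ∧
            (∃ T₀ : ℕ, (T₀ : ℝ) ≤ K * (‖A‖ ^ 2 * βg ^ 2 * β / (αg * δ ^ 2)) ∧
              SpectrahedronFW.ContractsFrom f β δ X T₀) ∧
            SpectrahedronFW.EigenvectorBound hn f X Xs
              (K * (βg ^ 2 * ‖A‖ ^ 2 / (αg * δ ^ 2))) := by
  open SpectrahedronFW SpectrahedronFW.SymMat in
  refine ⟨1000, by norm_num, fun n hn f β X hβ hc hf hX => ⟨fun t ht => ?_, ?_⟩⟩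
  · have hpos : 0 ≤ β / t := by positivity
    -- The rate holds against every competitor `Z`, so no minimizer is needed here.
    have h1 : f (X t) - 4 * (β / t) ≤ optVal f := by
      refine le_csInf ⟨_, Set.mem_image_of_mem f hX.1⟩ ?_
      rintro _ ⟨Z, hZ, rfl⟩
      linarith [hX.sub_le_div hβ hc hf hZ ht]
    linarith
  · intro Xs δ hopt hδeq hδ
    obtain ⟨u, hu, rfl, hdom⟩ := hopt.exists_eq_outer (hn := hn) (hf.1 _ hopt.1) (hδeq ▸ hδ)
    rw [← hδeq] at hdom
    -- As `1000/216 > 3`, this forces `β/δ ≤ 1/6`. Since squared distances are at most `2`, every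
    -- feasible point is then close enough to the minimizer.
    have hsmall : 1000 * (β / δ) ^ 3 < 3 → β ^ 2 * 18 ≤ δ ^ 2 := by
      intro hlt
      have h1 : β / δ ≤ 1 / 6 := by
        by_contra! h
        have : (1 / 6 : ℝ) ^ 3 < (β / δ) ^ 3 := by gcongr
        linarith
      rw [div_le_iff₀ hδ] at h1
      nlinarith
    have hlip : ∀ Z ∈ spectrahedron n,
        ‖gradient f Z - gradient f (outer u)‖ ^ 2 ≤ β ^ 2 * ‖Z - outer u‖ ^ 2 := fun Z hZ => by
      rw [← mul_pow]
      gcongr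
      exact hf.2 _ hZ _ hopt.1
    have hgrad : ∀ Z ∈ spectrahedron n, ‖gradient f Z - gradient f (outer u)‖ ^ 2
        ≤ 2 * β ^ 2 / δ * (f Z - f (outer u)) := fun Z hZ => by
      have h1 := norm_sub_sq_le_of_dominates hc (hf.1 _ hopt.1) hu hdom hδ hZ
      refine (hlip Z hZ).trans ((mul_le_mul_of_nonneg_left h1 (sq_nonneg β)).trans_eq ?_)
      ring
    refine ⟨?_, ?_, ?_, ?_⟩
    · refine hX.exists_contractsFrom hβ hc hf hu hopt hdom hδ (by positivity)
        (c := 2 * β ^ 2 / δ) (le_of_eq ?_) (by positivity) (fun hlt Z hZ => ?_) hgrad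
      · field_simp
      · have h1 := mul_le_mul_of_nonneg_left (norm_sub_sq_le_two hZ hopt.1) (sq_nonneg β)
        linarith [hlip Z hZ, hsmall hlt]
    · refine eigenvectorBound_of_gradient hX hu hopt hdom hδ ?_ hgrad
      have e : 4 / δ ^ 2 * (2 * β ^ 2 / δ) = 8 * (β ^ 2 / δ ^ 3) := by
        field_simp
        ring
      rw [e]
      gcongr
      norm_num
    · exact hX.exists_rank_eq_one hβ hc hf hu hopt hdom hδ hsmall
    · intro p g A M βg αg hs
      have hα := hs.2.1
      have hgrad' : ∀ Z ∈ spectrahedron n, ‖gradient f Z - gradient f (outer u)‖ ^ 2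
          ≤ 2 * (‖A‖ ^ 2 * βg ^ 2 / αg) * (f Z - f (outer u)) := fun Z hZ => by
        have h1 := hs.add_inner_gradient_add_le (outer u) Z
        have h2 := inner_gradient_nonneg_of_isMinOn convex_spectrahedron hopt.1 hZ hopt.2
          (hf.1 _ hopt.1)
        have h3 : αg * ‖A (Z - outer u)‖ ^ 2 ≤ 2 * (f Z - f (outer u)) := by linarith
        have h4 := mul_le_mul_of_nonneg_left h3
          (by positivity : 0 ≤ ‖A‖ ^ 2 * βg ^ 2 / αg)
        linarith [hs.norm_gradient_sub_sq_le Z (outer u)]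
      refine ⟨hs.isSmoothOn _, ?_, ?_⟩
      · refine hX.exists_contractsFrom hβ hc hf hu hopt hdom hδ (by positivity)
          (c := 2 * (‖A‖ ^ 2 * βg ^ 2 / αg)) (le_of_eq ?_) (by positivity)
          (fun hlt Z hZ => ?_) hgrad'
        · field_simp
        -- Strong monotonicity against `β`-smoothness gives `αg ‖A (Z - u uᵀ)‖² ≤ 2β`, which brings
        -- in `β` without comparing it to `‖A‖² βg`.
        · have h1 := hs.mul_norm_sq_le_inner Z (outer u)
          have h2 := real_inner_le_norm (gradient f Z - gradient f (outer u)) (Z - outer u)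
          have h3 := mul_le_mul_of_nonneg_right (hf.2 _ hZ _ hopt.1) (norm_nonneg (Z - outer u))
          have h4 := mul_le_mul_of_nonneg_left (norm_sub_sq_le_two hZ hopt.1) hβ.le
          have h5 : αg * ‖A (Z - outer u)‖ ^ 2 ≤ 2 * β := by nlinarith
          have h6 := mul_le_mul_of_nonneg_left h5
            (by positivity : 0 ≤ ‖A‖ ^ 2 * βg ^ 2 / αg)
          have h7 : ‖A‖ ^ 2 * βg ^ 2 / αg * (2 * β)
              = 2 * (‖A‖ ^ 2 * βg ^ 2 * β / (αg * δ ^ 2)) * δ ^ 2 := by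
            field_simp
          rw [h7] at h6
          have h8 := mul_le_mul_of_nonneg_right hlt.le (sq_nonneg δ)
          linarith [hs.norm_gradient_sub_sq_le Z (outer u), sq_nonneg δ]
      · refine eigenvectorBound_of_gradient hX hu hopt hdom hδ ?_ hgrad'
        have e : 4 / δ ^ 2 * (2 * (‖A‖ ^ 2 * βg ^ 2 / αg))
            = 8 * (βg ^ 2 * ‖A‖ ^ 2 / (αg * δ ^ 2)) := by
          field_simp
          ring
        rw [e]
        gcongr
        norm_num
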